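/- Conventions. Smooth manifolds are finite-dimensional, Hausdorff and second countable, and are regarded as diffeological spaces whose plots are the smooth maps from open subsets of Euclidean spaces. "Open" in a diffeological space refers to the D-topology (a set is open iff its preimage under every plot is open), and subsets carry the subset diffeology. A smooth map $f\colon X\to Y$ of diffeological spaces is a *local subduction* if for every plot $\phi\colon U\to Y$ ($U\subset\mathbb R^n$ open) and all $x\in X$, $u\in U$ with $\phi(u)=f(x)$ there are an open neighbourhood $V\subset U$ of $u$ and a plot $\widetilde\phi\colon V\to X$ with $\widetilde\phi(u)=x$ and $f\circ\widetilde\phi=\phi|_V$. A map $\pi\colon X\to Y$ of diffeological spaces is *quasi-étale* if (1) it is a local subduction, (2) its fibers are totally disconnected, i.e. every plot of a fiber is locally constant, and (3) for every open $\mathcal O\subset X$, every smooth map $f\colon\mathcal O\to X$ with $\pi\circ f=\pi|_{\mathcal O}$ is a local diffeomorphism. A diffeological space $X$ is *quasi-étale* if every $x\in X$ lies in the image of some quasi-étale map $\pi\colon M\to X$ with $M$ a smooth manifold (in particular the empty space is quasi-étale). $\mathbf{QUED}$ is the full subcategory of the category of diffeological spaces and smooth maps on the quasi-étale spaces. A morphism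 $p\colon X\to Z$ of a category is *cartesian* if for every morphism $f\colon Y\to Z$ either the fiber product of $p$ and $f$ exists in that category, or there are no commutative squares $p\circ a=f\circ b$ with $a\colon W\to X$, $b\colon W\to Y$. A *$\mathbf{QUED}$-submersion* is a morphism in $\mathbf{QUED}$ that is a local subduction and is cartesian in $\mathbf{QUED}$. **Theorem.** Let $p\colon X\to B$ be a morphism in $\mathbf{QUED}$ such that $B$ is a smooth manifold and $p$ is a local subduction. Then $p$ is a $\mathbf{QUED}$-submersion if and only if for every $b\in B$ the fiber $p^{-1}(b)$, with the subset diffeology, is a quasi-étale diffeological space. -/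

import Mathlib

universe u

open scoped ContDiff Manifold Topology

namespace QuasiEtale

open Diffeology CategoryTheory

/-- The subset diffeology: a map into a subtype is a plot iff it is a plot of the ambient space.
In particular every open `U ⊆ ℝⁿ` becomes a diffeological space, and the plots `U → X` of a
diffeological space `X` are exactly the smooth maps `U → X`. -/
instance subsetDiffeology {X : Type u} [DiffeologicalSpace X] (s : Set X) :
    DiffeologicalSpace s where
  plots n := {φ | IsPlot (fun t => (φ t : X))}
  constant_plots x := isPlot_const (x := (x : X))
  plot_reparam hφ hf := isPlot_reparam hφ hf
  locality hφ := DiffeologicalSpace.locality fun x => by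
    obtain ⟨v, hv, hxv, h⟩ := hφ x
    exact ⟨v, hv, hxv, fun hf hc => h hf hc⟩

/-- `V` is open in the D-topology. -/
def IsDOpen {X : Type*} [DiffeologicalSpace X] (V : Set X) : Prop :=
  IsOpen[Diffeology.dTopology] V

/-- A subset is totally disconnected if its subset diffeology is discrete, i.e. all plots
`φ : U → Y`, with `U` open in some `ℝⁿ`, are locally constant. -/
def IsDTotallyDisconnected {X : Type*} [DiffeologicalSpace X] (Y : Set X) : Prop :=
  ∀ (n : ℕ) (U : Set (EuclideanSpace ℝ (Fin n))), IsOpen U →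
    ∀ φ : U → Y, DSmooth φ → IsLocallyConstant φ

/-- Diffeomorphisms: smooth bijections with smooth inverse. -/
def IsDiffeo {X Y : Type*} [DiffeologicalSpace X] [DiffeologicalSpace Y] (f : X → Y) : Prop :=
  DSmooth f ∧ ∃ g : Y → X, Function.LeftInverse g f ∧ Function.RightInverse g f ∧ DSmooth g

/-- Local diffeomorphisms: every point has a D-open neighbourhood `U` with D-open image such that
`f` restricts to a diffeomorphism `U → f(U)`. -/
def IsLocalDiffeo {X Y : Type*} [DiffeologicalSpace X] [DiffeologicalSpace Y] (f : X → Y) :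
    Prop :=
  ∀ x : X, ∃ U : Set X, x ∈ U ∧ IsDOpen U ∧ IsDOpen (f '' U) ∧
    IsDiffeo (Set.imageFactorization f U)

/-- Local subductions: smooth maps `f : X → Y` such that every plot `φ : U → Y` with
`φ u = f x` lifts, on an open neighbourhood `V ⊆ U` of `u`, to a plot `ψ : V → X` with
`ψ u = x`. -/
def IsLocalSubduction {X Y : Type*} [DiffeologicalSpace X] [DiffeologicalSpace Y] (f : X → Y) :
    Prop :=
  DSmooth f ∧ ∀ (n : ℕ) (U : Set (EuclideanSpace ℝ (Fin n))), IsOpen U →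
    ∀ φ : U → Y, DSmooth φ → ∀ (x : X) (u : U), φ u = f x →
      ∃ (V : Set (EuclideanSpace ℝ (Fin n))) (hVU : V ⊆ U) (hu : u.1 ∈ V), IsOpen V ∧
        ∃ ψ : V → X, DSmooth ψ ∧ ψ ⟨u, hu⟩ = x ∧ ∀ v : V, φ ⟨v, hVU v.2⟩ = f (ψ v)

/-- Quasi-étale maps. -/
structure IsQuasiEtale {X Y : Type*} [DiffeologicalSpace X] [DiffeologicalSpace Y] (π : X → Y) :
    Prop where
  localSubduction : IsLocalSubduction π
  fiber_totallyDisconnected : ∀ y : Y, IsDTotallyDisconnected (π ⁻¹' {y})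
  localDiffeo : ∀ O : Set X, IsDOpen O → ∀ f : O → X, DSmooth f →
    (∀ x : O, π (f x) = π x) → IsLocalDiffeo f

/-- The diffeological space `M` is a (finite-dimensional, Hausdorff, second countable) smooth
manifold: it carries a smooth manifold structure whose smooth maps from the spaces `ℝᵐ` are
exactly the plots. -/
def IsSmoothManifold (M : Type*) [DiffeologicalSpace M] : Prop :=
  ∃ (n : ℕ) (_ : TopologicalSpace M) (_ : ChartedSpace (EuclideanSpace ℝ (Fin n)) M),
    IsManifold (𝓡 n) ∞ M ∧ T2Space M ∧ SecondCountableTopology M ∧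
      ∀ (m : ℕ) (φ : EuclideanSpace ℝ (Fin m) → M), IsPlot φ ↔ ContMDiff (𝓡 m) (𝓡 n) ∞ φ

/-- Quasi-étale diffeological spaces: around every point `x` there is a quasi-étale chart, that is,
a quasi-étale map from a smooth manifold with `x` in its image. (Second countable manifolds have
at most continuum many points, so those in `Type` are all of them up to diffeomorphism.) -/
def IsQUED (X : Type*) [DiffeologicalSpace X] : Prop :=
  ∀ x : X, ∃ (M : Type) (_ : DiffeologicalSpace M) (π : M → X),
    IsSmoothManifold M ∧ IsQuasiEtale π ∧ x ∈ Set.range π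

/-- Diffeological spaces, as the objects of a category. -/
structure Diffgl : Type (u + 1) where
  carrier : Type u
  [str : DiffeologicalSpace carrier]

instance : CoeSort Diffgl.{u} (Type u) := ⟨Diffgl.carrier⟩

instance (X : Diffgl.{u}) : DiffeologicalSpace X := X.str

/-- Morphisms of diffeological spaces are the smooth maps. -/
@[ext]
structure Diffgl.Hom (X Y : Diffgl.{u}) : Type u where
  toFun : X → Y
  smooth : DSmooth toFun

instance : Category.{u} Diffgl.{u} where
  Hom := Diffgl.Hom
  id _ := ⟨id, dSmooth_id⟩
  comp f g := ⟨g.toFun ∘ f.toFun, g.smooth.comp f.smooth⟩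

/-- The full subcategory of `Diffgl` on the quasi-étale diffeological spaces. -/
abbrev QUED : Type (u + 1) :=
  ObjectProperty.FullSubcategory (fun X : Diffgl.{u} => IsQUED X)

/-- The diffeological space underlying an object of `QUED`. -/
abbrev QUED.space (X : QUED.{u}) : Type u := X.obj

/-- The smooth map underlying a morphism of `QUED`. -/
abbrev QUED.map {X Y : QUED.{u}} (p : X ⟶ Y) : X.space → Y.space :=
  Diffgl.Hom.toFun p.hom

/-- A morphism `p : X ⟶ Z` of a category is cartesian if for every `f : Y ⟶ Z` either the fibre
product of `p` and `f` exists, or there is no commutative square on `p` and `f` at all. -/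
def IsCartesianMorphism {C : Type*} [Category C] {X Z : C} (p : X ⟶ Z) : Prop :=
  ∀ ⦃Y : C⦄ (f : Y ⟶ Z), Limits.HasPullback p f ∨
    ¬ ∃ (W : C) (a : W ⟶ X) (b : W ⟶ Y), a ≫ p = b ≫ f

/-- `QUED`-submersions: local subductions that are cartesian in `QUED`. -/
def IsQUEDSubmersion {X Z : QUED.{u}} (p : X ⟶ Z) : Prop :=
  IsLocalSubduction (QUED.map p) ∧ IsCartesianMorphism p

end QuasiEtale

/-!
The fibre product `X ×_B Y` of diffeological spaces computes the fibre product in `QUED` whenever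
it is quasi-étale, so the theorem compares quasi-étaleness of the fibres of `p` with that of
`X ×_B Y` for all quasi-étale `Y → B`.

If `p` is cartesian and `p⁻¹(b)` is non-empty, the fibre product of `p` with the point `b` exists in
`QUED`. The spaces `ℝⁿ` are objects of `QUED`, and testing the universal property against them
identifies this fibre product with `p⁻¹(b)`, as a set and as a diffeological space
(`IsCartesianMorphism.isQUED_fiber`).

Conversely, every quasi-étale space is covered by quasi-étale maps from the spaces `ℝⁿ`, and for
these the condition that self-maps over `X` are local diffeomorphisms says, by the inverse function
theorem, that every smooth germ `f` with `π ∘ f = π` has an injective derivative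
(`IsEuclideanChart`). As `B` is a manifold and `p` is a local subduction, a chart `π` of `X` can be
chosen on `ℝᵏ × ℝˡ` such that `p ∘ π` is the projection to `ℝᵏ` followed by a chart `c` of `B`. If
`ρ` is a chart of `Y` on `ℝᵐ` and `q : ℝᵐ → ℝᵏ` is the map to `B` it induces, then
`(a, v) ↦ (π (q v, a), ρ v)` is a local subduction `ℝˡ × ℝᵐ → X ×_B Y` with totally disconnected
fibres. For the remaining condition, let `F = (F₁, F₂)` be a germ over `X ×_B Y`. Along `v`, the
component `F₂` is a germ over `ρ`, so `∂F₂/∂v` is injective; along `a`, it stays in a fibre of `ρ`,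
so `∂F₂/∂a = 0`; and `F₁` along `a` is a germ over the slice `a ↦ π (t, a)`, a local subduction
with totally disconnected fibres onto an open part of `p⁻¹(c t)`. Such a map into a quasi-étale space is
automatically quasi-étale (`IsLocalSubduction.isEuclideanChart_of_isQUED`), so `∂F₁/∂a` is
injective. This is where the hypothesis on the fibres enters. Hence the derivative of `F` is
injective (`IsEuclideanChart.fiberProduct`).
-/

namespace QuasiEtale

open Diffeology CategoryTheory Filter Set

/-! ### Plots defined on all of Euclidean space -/

/-- The Euclidean space `ℝⁿ`. -/
abbrev Euc (n : ℕ) : Type := EuclideanSpace ℝ (Fin n)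

/-- Every point of an open set `U ⊆ ℝⁿ` has a smooth map `ℝⁿ → U` that is the identity near it.
Precomposition with it replaces a smooth germ by a map defined on all of `ℝⁿ`. -/
theorem exists_contDiff_forall_mem_eventuallyEq_id {n : ℕ} {U : Set (Euc n)} {x : Euc n}
    (hU : U ∈ 𝓝 x) : ∃ r : Euc n → Euc n, ContDiff ℝ ∞ r ∧ (∀ v, r v ∈ U) ∧ r =ᶠ[𝓝 x] id := by
  obtain ⟨ε, hε, hεU⟩ := Metric.mem_nhds_iff.1 hU
  -- Scale `v - x` by a bump function.
  let b : ContDiffBump x := ⟨ε / 4, ε / 2, by positivity, by linarith⟩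
  refine ⟨fun v => x + b v • (v - x), ?_, fun v => hεU ?_, ?_⟩
  · exact contDiff_const.add (b.contDiff.smul (contDiff_id.sub contDiff_const))
  · rw [Metric.mem_ball, dist_eq_norm, add_sub_cancel_left, norm_smul, Real.norm_of_nonneg b.nonneg]
    by_cases hv : dist v x < ε / 2
    · rw [dist_eq_norm] at hv
      calc b v * ‖v - x‖ ≤ 1 * ‖v - x‖ := by gcongr; exact b.le_one
        _ < ε := by linarith
    · rw [b.zero_of_le_dist (not_lt.1 hv)]
      simpa using hε
  · filter_upwards [b.eventuallyEq_one] with v hv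
    simp [hv]

theorem isPlot_iff_contDiff_euc {m n : ℕ} {f : Euc m → Euc n} : IsPlot f ↔ ContDiff ℝ ∞ f :=
  isPlot_iff_contDiff

section Basic

variable {X Y Z : Type*} [DiffeologicalSpace X] [DiffeologicalSpace Y] [DiffeologicalSpace Z]

theorem isDOpen_euc_iff {n : ℕ} {U : Set (Euc n)} : IsDOpen U ↔ IsOpen U := by
  rw [IsDOpen, IsDTopologyCompatible.dTop_eq]

theorem isPlot_of_locally_eq {n : ℕ} {φ : Euc n → X}
    (h : ∀ u, ∃ ψ : Euc n → X, IsPlot ψ ∧ φ =ᶠ[𝓝 u] ψ) : IsPlot φ := by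
  refine DiffeologicalSpace.locality fun u => ?_
  obtain ⟨ψ, hψ, he⟩ := h u
  obtain ⟨W, hW, hWo, huW⟩ := eventually_nhds_iff.1 he
  refine ⟨W, hWo, huW, fun {m f} hf hfs => ?_⟩
  have : φ ∘ f = ψ ∘ f := funext fun v => hW _ (hf v)
  rw [this]
  exact isPlot_reparam hψ hfs

/-- A smooth map on an open subset of `ℝⁿ` extends, near each point, to a plot. -/
theorem exists_isPlot_eventuallyEq {n : ℕ} {U : Set (Euc n)} (hU : IsOpen U) {φ : U → X}
    (hφ : DSmooth φ) (u : U) :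
    ∃ ψ : Euc n → X, IsPlot ψ ∧ (∀ v, ψ v ∈ range φ) ∧ ψ u = φ u ∧
      ∀ᶠ v in 𝓝 u.1, ∃ h : v ∈ U, ψ v = φ ⟨v, h⟩ := by
  obtain ⟨r, hr, hrU, hre⟩ := exists_contDiff_forall_mem_eventuallyEq_id (hU.mem_nhds u.2)
  refine ⟨fun v => φ ⟨r v, hrU v⟩, ?_, fun v => ⟨_, rfl⟩, ?_, ?_⟩
  · exact hφ n (fun v => ⟨r v, hrU v⟩) (isPlot_iff_contDiff_euc.2 hr)
  · exact congrArg φ (Subtype.ext hre.self_of_nhds)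
  · filter_upwards [hre, hU.mem_nhds u.2] with v hv hvU
    exact ⟨hvU, congrArg φ (Subtype.ext hv)⟩

theorem dSmooth_subtypeVal {s : Set X} : DSmooth (Subtype.val : s → X) := fun _ _ hp => hp

/-- Local subductions can be tested on plots defined on all of `ℝⁿ`. -/
theorem isLocalSubduction_iff {f : X → Y} :
    IsLocalSubduction f ↔ DSmooth f ∧ ∀ (n : ℕ) (φ : Euc n → Y), IsPlot φ → ∀ x u, φ u = f x →
      ∃ ψ : Euc n → X, IsPlot ψ ∧ ψ u = x ∧ ∀ᶠ v in 𝓝 u, φ v = f (ψ v) := by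
  refine and_congr_right fun _ => ⟨fun h n φ hφ x u hx => ?_, fun h n U hU φ hφ x u hx => ?_⟩
  · obtain ⟨V, _, huV, hV, ψ, hψ, hψu, hψe⟩ :=
      h n univ isOpen_univ (fun v => φ v) (hφ.dSmooth.comp dSmooth_subtypeVal) x ⟨u, trivial⟩ hx
    obtain ⟨ψ', hψ', -, hu, he⟩ := exists_isPlot_eventuallyEq hV hψ ⟨u, huV⟩
    refine ⟨ψ', hψ', hu.trans hψu, ?_⟩
    filter_upwards [he] with v ⟨hv, hv'⟩
    rw [hv']
    exact hψe ⟨v, hv⟩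
  · obtain ⟨φ', hφ', -, hu, he⟩ := exists_isPlot_eventuallyEq hU hφ u
    obtain ⟨ψ, hψ, hψu, hψe⟩ := h n φ' hφ' x u (hu.trans hx)
    obtain ⟨V, hV, hVo, huV⟩ := eventually_nhds_iff.1 (he.and hψe)
    refine ⟨V, fun v hv => (hV v hv).1.1, huV, hVo, fun v => ψ v,
      hψ.dSmooth.comp dSmooth_subtypeVal, hψu, fun v => ?_⟩
    rw [← (hV v v.2).2, (hV v v.2).1.2]

theorem IsLocalSubduction.exists_lift {f : X → Y} (hf : IsLocalSubduction f) {n : ℕ}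
    {φ : Euc n → Y} (hφ : IsPlot φ) {x : X} {u : Euc n} (h : φ u = f x) :
    ∃ ψ : Euc n → X, IsPlot ψ ∧ ψ u = x ∧ ∀ᶠ v in 𝓝 u, φ v = f (ψ v) :=
  (isLocalSubduction_iff.1 hf).2 n φ hφ x u h

theorem IsPlot.tendsto_euc {m n : ℕ} {f : Euc m → Euc n} (hf : IsPlot f) {x : Euc m}
    {y : Euc n} (h : f x = y) : Tendsto f (𝓝 x) (𝓝 y) :=
  h ▸ (isPlot_iff_contDiff_euc.1 hf).continuous.continuousAt

theorem IsLocalSubduction.comp {g : Y → Z} {f : X → Y} (hg : IsLocalSubduction g)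
    (hf : IsLocalSubduction f) : IsLocalSubduction (g ∘ f) := by
  refine isLocalSubduction_iff.2 ⟨hg.1.comp hf.1, fun n φ hφ x u hx => ?_⟩
  obtain ⟨ψ, hψ, hψu, hψe⟩ := hg.exists_lift hφ hx
  obtain ⟨χ, hχ, hχu, hχe⟩ := hf.exists_lift hψ hψu
  refine ⟨χ, hχ, hχu, ?_⟩
  filter_upwards [hψe, hχe] with v h1 h2
  rw [h1, h2, Function.comp_apply]

/-- Local subductions are open for the D-topologies. -/
theorem IsLocalSubduction.isDOpen_image {f : X → Y} (hf : IsLocalSubduction f) {W : Set X}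
    (hW : IsDOpen W) : IsDOpen (f '' W) := by
  rw [IsDOpen, isOpen_iff_preimages_plots] at hW ⊢
  refine fun n φ hφ => isOpen_iff_mem_nhds.2 fun u ⟨w, hw, hwu⟩ => ?_
  obtain ⟨ψ, hψ, hψu, hψe⟩ := hf.exists_lift hφ hwu.symm
  filter_upwards [hψe, (hW n ψ hψ).mem_nhds (show u ∈ ψ ⁻¹' W by simpa [hψu] using hw)] with v h1 h2
  exact ⟨_, h2, h1.symm⟩

end Basic

/-- The fibres of `π` are totally disconnected iff the plots defined on all of `ℝⁿ` that stay in
one fibre are constant. -/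
theorem forall_isDTotallyDisconnected_fiber_iff {X Y : Type*} [DiffeologicalSpace X]
    {π : X → Y} :
    (∀ y, IsDTotallyDisconnected (π ⁻¹' {y})) ↔
      ∀ (n : ℕ) (φ : Euc n → X), IsPlot φ → (∀ v w, π (φ v) = π (φ w)) → ∀ v w, φ v = φ w := by
  refine ⟨fun h n φ hφ hc v w => ?_, fun h y n U hU φ hφ => ?_⟩
  · have := h (π (φ v)) n univ isOpen_univ (fun t => ⟨φ t, hc t v⟩)
      (hφ.dSmooth.comp dSmooth_subtypeVal)
    have hs : PreconnectedSpace (univ : Set (Euc n)) :=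
      isPreconnected_iff_preconnectedSpace.1 isPreconnected_univ
    exact congrArg Subtype.val (this.apply_eq_of_preconnectedSpace ⟨v, trivial⟩ ⟨w, trivial⟩)
  · refine (IsLocallyConstant.iff_eventually_eq φ).2 fun u => ?_
    obtain ⟨ψ, hψ, -, hu, he⟩ := exists_isPlot_eventuallyEq hU hφ u
    have hc := h n _ (hψ.dSmooth_comp dSmooth_subtypeVal) fun v w =>
      (show π (ψ v) = y from (ψ v).2).trans (show π (ψ w) = y from (ψ w).2).symm
    filter_upwards [continuous_subtype_val.continuousAt.eventually he] with v ⟨hv, hv'⟩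
    rw [← hu]
    exact hv'.symm.trans (Subtype.ext (hc _ _))

/-! ### Inverse function theorem and submersions -/

theorem fderiv_comp_of_isPlot {n m k : ℕ} {f : Euc m → Euc k} {g : Euc n → Euc m}
    (hf : IsPlot f) (hg : IsPlot g) (x : Euc n) :
    fderiv ℝ (f ∘ g) x = (fderiv ℝ f (g x)).comp (fderiv ℝ g x) :=
  fderiv_comp x ((isPlot_iff_contDiff_euc.1 hf).differentiable (by simp) _)
    ((isPlot_iff_contDiff_euc.1 hg).differentiable (by simp) _)

theorem surjective_fderiv_of_rightInverse {n m : ℕ} {f : Euc m → Euc n} {g : Euc n → Euc m}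
    (hf : IsPlot f) (hg : IsPlot g) {x : Euc n} {y : Euc m} (hy : g x = y)
    (h : ∀ᶠ v in 𝓝 x, f (g v) = v) : Function.Surjective (fderiv ℝ f y) := fun w => by
  have hid : fderiv ℝ (f ∘ g) x = ContinuousLinearMap.id ℝ (Euc n) := by
    rw [(show f ∘ g =ᶠ[𝓝 x] id from h).fderiv_eq, fderiv_id]
  rw [fderiv_comp_of_isPlot hf hg, hy] at hid
  exact ⟨fderiv ℝ g x w, DFunLike.congr_fun hid w⟩

/-- Inverse function theorem for smooth maps, with an inverse that is smooth on an open set. -/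
theorem exists_openPartialHomeomorph_of_injective_fderiv {n : ℕ} {f : Euc n → Euc n}
    (hf : ContDiff ℝ ∞ f) {x : Euc n} (hx : Function.Injective (fderiv ℝ f x)) :
    ∃ e : OpenPartialHomeomorph (Euc n) (Euc n), x ∈ e.source ∧ ⇑e = f ∧
      ContDiffOn ℝ ∞ e.symm e.target := by
  have key : ∀ y, Function.Injective (fderiv ℝ f y) →
      ∃ f' : Euc n ≃L[ℝ] Euc n, HasFDerivAt f (f' : Euc n →L[ℝ] Euc n) y := fun y hy => by
    let L := LinearEquiv.ofInjectiveEndo (fderiv ℝ f y : Euc n →ₗ[ℝ] Euc n) hy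
    refine ⟨L.toContinuousLinearEquiv, (hf.differentiable (by simp) y).hasFDerivAt.congr_fderiv ?_⟩
    ext1 v
    rfl
  obtain ⟨f', hf'⟩ := key x hx
  let e := hf.contDiffAt.toOpenPartialHomeomorph f hf' (by simp)
  have hopen : IsOpen {y | Function.Injective (fderiv ℝ f y)} := by
    have : {y | Function.Injective (fderiv ℝ f y)} =
        (fderiv ℝ f) ⁻¹' {L | Function.Injective L} := rfl
    rw [this]
    exact ContinuousLinearMap.isOpen_injective.preimage (hf.continuous_fderiv (by simp))
  -- The local inverse is smooth at the images of the points where the derivative is invertible.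
  refine ⟨e.restrOpen _ hopen, ⟨?_, hx⟩, rfl, fun y hy => ?_⟩
  · exact hf.contDiffAt.mem_toOpenPartialHomeomorph_source hf' (by simp)
  · have hy' := (e.restrOpen _ hopen).map_target hy
    obtain ⟨g', hg'⟩ := key ((e.restrOpen _ hopen).symm y) hy'.2
    exact ((e.restrOpen _ hopen).contDiffAt_symm hy hg' hf.contDiffAt).contDiffWithinAt

/-- A smooth map from `ℝⁿ` into an open subset of `ℝᵐ` with a smooth inverse on that subset is a
local subduction. -/
theorem isLocalSubduction_of_contDiffOn_inverse {n m : ℕ} {h : Euc n → Euc m} {k : Euc m → Euc n}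
    {R : Set (Euc m)} (hR : IsOpen R) (hh : ContDiff ℝ ∞ h) (hk : ContDiffOn ℝ ∞ k R)
    (hhR : ∀ v, h v ∈ R) (hkh : ∀ v, k (h v) = v) (hhk : ∀ w ∈ R, h (k w) = w) :
    IsLocalSubduction h := by
  refine isLocalSubduction_iff.2 ⟨(isPlot_iff_contDiff_euc.2 hh).dSmooth, fun i φ hφ x u hx => ?_⟩
  obtain ⟨r, hr, hrR, hre⟩ := exists_contDiff_forall_mem_eventuallyEq_id (x := φ u)
    (hR.mem_nhds (hx ▸ hhR x))
  have hφ' := isPlot_iff_contDiff_euc.1 hφ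
  refine ⟨fun v => k (r (φ v)), isPlot_iff_contDiff_euc.2
    (hk.comp_contDiff (hr.comp hφ') fun v => hrR _), ?_, ?_⟩
  · change k (r (φ u)) = x
    rw [hre.self_of_nhds, id, hx, hkh]
  · filter_upwards [hφ'.continuous.continuousAt.eventually hre] with v hv
    rw [hhk _ (hrR _), hv, id]

theorem isLocalSubduction_univBall {n : ℕ} (x : Euc n) {ε : ℝ} (hε : 0 < ε) :
    IsLocalSubduction (OpenPartialHomeomorph.univBall x ε : Euc n → Euc n) := by
  have ht := OpenPartialHomeomorph.univBall_target x hε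
  have hs := OpenPartialHomeomorph.univBall_source x ε
  refine isLocalSubduction_of_contDiffOn_inverse Metric.isOpen_ball
    OpenPartialHomeomorph.contDiff_univBall
    (OpenPartialHomeomorph.contDiffOn_univBall_symm (c := x) (r := ε)) (fun v => ?_) (fun v => ?_)
    fun w hw => ?_
  · exact ht ▸ (OpenPartialHomeomorph.univBall x ε).map_source (hs ▸ mem_univ v)
  · exact (OpenPartialHomeomorph.univBall x ε).left_inv (hs ▸ mem_univ v)
  · exact (OpenPartialHomeomorph.univBall x ε).right_inv (ht ▸ hw)

theorem injective_univBall {n : ℕ} (x : Euc n) (ε : ℝ) :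
    Function.Injective (OpenPartialHomeomorph.univBall x ε : Euc n → Euc n) := by
  rw [← injOn_univ, ← OpenPartialHomeomorph.univBall_source x ε]
  exact (OpenPartialHomeomorph.univBall x ε).injOn

theorem univBall_mem_ball {n : ℕ} (x : Euc n) {ε : ℝ} (hε : 0 < ε) (v : Euc n) :
    OpenPartialHomeomorph.univBall x ε v ∈ Metric.ball x ε :=
  OpenPartialHomeomorph.univBall_target x hε ▸ (OpenPartialHomeomorph.univBall x ε).map_source
    (OpenPartialHomeomorph.univBall_source x ε ▸ mem_univ v)

/-- A smooth map that is a submersion at `x` becomes, near `x` and up to open embeddings of source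
and target, a linear projection. -/
theorem exists_straightening_of_surjective_fderiv {n k : ℕ} {g : Euc n → Euc k} (hg : IsPlot g)
    {x : Euc n} (hx : Function.Surjective (fderiv ℝ g x)) {W : Set (Euc n)} (hW : W ∈ 𝓝 x) :
    ∃ (l : ℕ) (τ : Euc n ≃L[ℝ] Euc k × Euc l) (j : Euc n → Euc n) (β : Euc k → Euc k),
      IsLocalSubduction j ∧ Function.Injective j ∧ j 0 = x ∧ (∀ v, j v ∈ W) ∧
      IsLocalSubduction β ∧ Function.Injective β ∧ β 0 = g x ∧ ∀ v, g (j v) = β (τ v).1 := by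
  have hg' := isPlot_iff_contDiff_euc.1 hg
  obtain ⟨W, hWW, hWo, hxW⟩ := mem_nhds_iff.1 hW
  -- Complement `g` by the orthogonal projection to the kernel of its derivative.
  let D := fderiv ℝ g x
  let K : Submodule ℝ (Euc n) := LinearMap.ker (D : Euc n →ₗ[ℝ] Euc k)
  let l := Module.finrank ℝ K
  let κ : K ≃L[ℝ] Euc l := ContinuousLinearEquiv.ofFinrankEq (by simp [l])
  let Q : Euc n →L[ℝ] Euc l := (κ : K →L[ℝ] Euc l).comp K.orthogonalProjectionOnto
  have hrank : Module.finrank ℝ (Euc n) = Module.finrank ℝ (Euc k × Euc l) := by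
    have h1 := LinearMap.finrank_range_add_finrank_ker (D : Euc n →ₗ[ℝ] Euc k)
    rw [LinearMap.range_eq_top.2 hx, finrank_top] at h1
    rw [← h1, Module.finrank_prod, finrank_euclideanSpace_fin (n := l)]
  let τ : Euc n ≃L[ℝ] Euc k × Euc l := ContinuousLinearEquiv.ofFinrankEq hrank
  let F : Euc n → Euc n := fun v => τ.symm (g v, Q v)
  have hF : ContDiff ℝ ∞ F := τ.symm.contDiff.comp (hg'.prodMk Q.contDiff)
  have hF' : HasFDerivAt F ((τ.symm : Euc k × Euc l →L[ℝ] Euc n).comp (D.prod Q)) x :=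
    τ.symm.hasFDerivAt.comp x
      ((hg'.differentiable (by simp) x).hasFDerivAt.prodMk Q.hasFDerivAt)
  have hFinj : Function.Injective (fderiv ℝ F x) := by
    rw [hF'.fderiv]
    refine (injective_iff_map_eq_zero _).2 fun v hv => ?_
    have hv' : (D v, Q v) = 0 := τ.symm.injective (hv.trans (map_zero τ.symm).symm)
    have hvK : v ∈ K := congrArg Prod.fst hv'
    have hvQ : K.orthogonalProjectionOnto v = 0 :=
      κ.injective ((congrArg Prod.snd hv').trans (map_zero κ).symm)
    have := Submodule.orthogonalProjectionOnto_mem_subspace_eq_self (K := K) ⟨v, hvK⟩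
    exact congrArg Subtype.val (this.symm.trans hvQ)
  obtain ⟨e, hxe, heF, hes⟩ := exists_openPartialHomeomorph_of_injective_fderiv hF hFinj
  have hex : e x = τ.symm (g x, Q x) := congrFun heF x
  have hT : τ.symm ⁻¹' (e.target ∩ e.symm ⁻¹' W) ∈ 𝓝 (g x, Q x) := by
    refine τ.symm.continuous.continuousAt ((e.isOpen_inter_preimage_symm hWo).mem_nhds ?_)
    rw [← hex]
    exact ⟨e.map_source hxe, by simpa [e.left_inv hxe] using hxW⟩
  obtain ⟨ε, hε, hεT⟩ := Metric.mem_nhds_iff.1 hT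
  rw [← ball_prod_same] at hεT
  let b₁ := OpenPartialHomeomorph.univBall (g x) ε
  let b₂ := OpenPartialHomeomorph.univBall (Q x) ε
  let b : Euc n → Euc n := fun v => τ.symm (b₁ (τ v).1, b₂ (τ v).2)
  have hb : ContDiff ℝ ∞ b := τ.symm.contDiff.comp
    ((OpenPartialHomeomorph.contDiff_univBall.comp (contDiff_fst.comp τ.contDiff)).prodMk
      (OpenPartialHomeomorph.contDiff_univBall.comp (contDiff_snd.comp τ.contDiff)))
  have hbT : ∀ v, b v ∈ e.target ∩ e.symm ⁻¹' W := fun v =>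
    hεT ⟨univBall_mem_ball _ hε _, univBall_mem_ball _ hε _⟩
  let j : Euc n → Euc n := fun v => e.symm (b v)
  have hgj : ∀ v, (g (j v), Q (j v)) = (b₁ (τ v).1, b₂ (τ v).2) := fun v => by
    have := e.right_inv (hbT v).1
    rw [heF] at this
    exact τ.symm.injective this
  have hkj : ∀ v, τ.symm (b₁.symm (g (j v)), b₂.symm (Q (j v))) = v := fun v => by
    obtain ⟨h1, h2⟩ := Prod.mk.inj (hgj v)
    rw [h1, h2, b₁.left_inv (by simp [b₁]), b₂.left_inv (by simp [b₂])]
    exact τ.symm_apply_apply v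
  have ht₁ : b₁.target = Metric.ball (g x) ε := OpenPartialHomeomorph.univBall_target _ hε
  have ht₂ : b₂.target = Metric.ball (Q x) ε := OpenPartialHomeomorph.univBall_target _ hε
  let R : Set (Euc n) := e.source ∩ (g ⁻¹' b₁.target ∩ Q ⁻¹' b₂.target)
  have hj : IsLocalSubduction j := by
    refine isLocalSubduction_of_contDiffOn_inverse (R := R)
      (k := fun v => τ.symm (b₁.symm (g v), b₂.symm (Q v))) ?_ (hes.comp_contDiff hb fun v =>
        (hbT v).1) ?_ (fun v => ⟨e.map_target (hbT v).1, ?_, ?_⟩) hkj fun v hv => ?_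
    · exact e.open_source.inter ((b₁.open_target.preimage hg'.continuous).inter
        (b₂.open_target.preimage Q.continuous))
    · have h₁ : ContDiffOn ℝ ∞ b₁.symm b₁.target :=
        ht₁ ▸ OpenPartialHomeomorph.contDiffOn_univBall_symm
      have h₂ : ContDiffOn ℝ ∞ b₂.symm b₂.target :=
        ht₂ ▸ OpenPartialHomeomorph.contDiffOn_univBall_symm
      exact τ.symm.contDiff.comp_contDiffOn
        ((h₁.comp hg'.contDiffOn fun v hv => hv.2.1).prodMk
          (h₂.comp Q.contDiff.contDiffOn fun v hv => hv.2.2))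
    · rw [mem_preimage, (Prod.mk.inj (hgj v)).1]
      exact b₁.map_source (by simp [b₁])
    · rw [mem_preimage, (Prod.mk.inj (hgj v)).2]
      exact b₂.map_source (by simp [b₂])
    · have : b (τ.symm (b₁.symm (g v), b₂.symm (Q v))) = e v := by
        simp only [b, ContinuousLinearEquiv.apply_symm_apply, b₁.right_inv hv.2.1,
          b₂.right_inv hv.2.2, heF, F]
      simp only [j, this, e.left_inv hv.1]
  refine ⟨l, τ, j, b₁, hj, Function.LeftInverse.injective
      (g := fun v => τ.symm (b₁.symm (g v), b₂.symm (Q v))) hkj, ?_,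
    fun v => hWW (hbT v).2, isLocalSubduction_univBall _ hε, injective_univBall _ _,
    OpenPartialHomeomorph.univBall_apply_zero _ _, fun v => (Prod.mk.inj (hgj v)).1⟩
  have : b 0 = e x := by
    simp [b, b₁, b₂, hex]
  simp only [j, this, e.left_inv hxe]

/-! ### Euclidean charts -/

/-- A quasi-étale map `ℝⁿ → X`, described by means of maps defined on all of `ℝⁿ`: the fibres are
totally disconnected because plots inside a fibre are constant, and the smooth germs of `ℝⁿ` over
`X` are required to have an injective derivative instead of being local diffeomorphisms. -/
structure IsEuclideanChart {X : Type*} [DiffeologicalSpace X] {n : ℕ} (π : Euc n → X) : Prop where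
  localSubduction : IsLocalSubduction π
  eq_of_comp_const : ∀ (m : ℕ) (φ : Euc m → Euc n), IsPlot φ →
    (∀ v w, π (φ v) = π (φ w)) → ∀ v w, φ v = φ w
  injective_fderiv : ∀ f : Euc n → Euc n, IsPlot f → ∀ x, (∀ᶠ v in 𝓝 x, π (f v) = π v) →
    Function.Injective (fderiv ℝ f x)

section

variable {X Y : Type*} [DiffeologicalSpace X] [DiffeologicalSpace Y]

/-- The inverse, on its image, of an injective local subduction is smooth. -/
theorem IsLocalSubduction.isPlot_of_comp {c : X → Y} (hc : IsLocalSubduction c)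
    (hi : Function.Injective c) {n : ℕ} {φ : Euc n → X} (h : IsPlot (c ∘ φ)) : IsPlot φ := by
  refine isPlot_of_locally_eq fun u => ?_
  obtain ⟨ψ, hψ, -, hψe⟩ := hc.exists_lift h (x := φ u) rfl
  exact ⟨ψ, hψ, hψe.mono fun v hv => hi hv⟩

/-- The composite of a quasi-étale map with an open embedding of `ℝⁿ` is a Euclidean chart. -/
theorem IsQuasiEtale.isEuclideanChart_comp {π : X → Y} (hπ : IsQuasiEtale π) {n : ℕ}
    {c : Euc n → X} (hc : IsLocalSubduction c) (hi : Function.Injective c) :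
    IsEuclideanChart (π ∘ c) where
  localSubduction := hπ.localSubduction.comp hc
  eq_of_comp_const m φ hφ h v w :=
    hi (forall_isDTotallyDisconnected_fiber_iff.1 hπ.fiber_totallyDisconnected m (c ∘ φ)
      (hφ.dSmooth_comp hc.1) h v w)
  injective_fderiv f hf x hx := by
    obtain ⟨W, hW, hWo, hxW⟩ := eventually_nhds_iff.1 hx
    have hinv : ∀ o : c '' W, c (Function.invFun c o) = o := fun o =>
      Function.invFun_eq (o.2.imp fun _ h => h.2)
    have hinvW : ∀ o : c '' W, Function.invFun c o ∈ W := by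
      rintro ⟨_, w, hw, rfl⟩
      rwa [Function.leftInverse_invFun hi]
    -- The germ of `f`, transported along `c`, is a lift of the identity over `π`.
    let g : c '' W → X := fun o => c (f (Function.invFun c o))
    have hg : DSmooth g := fun m φ hφ => by
      have : IsPlot fun v => Function.invFun c (φ v : X) := by
        refine hc.isPlot_of_comp hi (?_ : IsPlot fun v => _)
        simp only [Function.comp_apply, hinv]
        exact hφ
      exact (this.dSmooth_comp' hf.dSmooth).dSmooth_comp' hc.1
    obtain ⟨U, hxU, -, hgU, -, h, hl, hr', hh⟩ := hπ.localDiffeo _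
      (hc.isDOpen_image (isDOpen_euc_iff.2 hWo)) g hg
      (fun o => (hW _ (hinvW o)).trans (congrArg π (hinv o))) ⟨c x, mem_image_of_mem c hxW⟩
    have hgx : g ⟨c x, mem_image_of_mem c hxW⟩ = c (f x) := by
      simp only [g, Function.leftInverse_invFun hi x]
    -- The local inverse of `g`, transported back, is a right inverse of `f` near `f x`.
    have hcU : IsOpen (c ⁻¹' (g '' U)) :=
      isOpen_iff_preimages_plots.1 hgU n c hc.1.isPlot
    obtain ⟨r, hr, hrU, hre⟩ := exists_contDiff_forall_mem_eventuallyEq_id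
      (hcU.mem_nhds (show f x ∈ _ from ⟨_, hxU, hgx⟩))
    have hφ : IsPlot fun w => ((h ⟨c (r w), hrU w⟩ : U) : X) :=
      hh n (fun w => ⟨c (r w), hrU w⟩) ((isPlot_iff_contDiff_euc.2 hr).dSmooth_comp' hc.1)
    have hφx : ((h ⟨c (r (f x)), hrU (f x)⟩ : U) : X) = c x := by
      have : (⟨c (r (f x)), hrU (f x)⟩ : g '' U) = imageFactorization g U ⟨_, hxU⟩ :=
        Subtype.ext ((congrArg c hre.self_of_nhds).trans hgx.symm)
      rw [this, hl]
    obtain ⟨G, hG, hGx, hGe⟩ := hc.exists_lift hφ hφx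
    refine LinearMap.injective_iff_surjective.2 (surjective_fderiv_of_rightInverse hf hG hGx ?_)
    filter_upwards [hGe, hre] with w h1 h2
    have h3 : g (h ⟨c (r w), hrU w⟩ : U) = c (r w) :=
      congrArg Subtype.val (hr' ⟨c (r w), hrU w⟩)
    have h4 : Function.invFun c ((h ⟨c (r w), hrU w⟩ : U) : X) = G w := by
      rw [h1, Function.leftInverse_invFun hi]
    refine Eq.trans (hi (Eq.trans ?_ h3)) h2
    simp only [g, h4]

end

theorem IsLocalSubduction.isEuclideanChart {X : Type*} [DiffeologicalSpace X] {n : ℕ}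
    {c : Euc n → X} (hc : IsLocalSubduction c) (hi : Function.Injective c) :
    IsEuclideanChart c where
  localSubduction := hc
  eq_of_comp_const _ _ _ h v w := hi (h v w)
  injective_fderiv f _ x hx := by
    rw [(show f =ᶠ[𝓝 x] id from hx.mono fun v hv => hi hv).fderiv_eq, fderiv_id]
    exact Function.injective_id

/-- By the inverse function theorem, Euclidean charts are quasi-étale. -/
theorem IsEuclideanChart.isQuasiEtale {X : Type*} [DiffeologicalSpace X] {n : ℕ}
    {π : Euc n → X} (hπ : IsEuclideanChart π) : IsQuasiEtale π where
  localSubduction := hπ.localSubduction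
  fiber_totallyDisconnected := forall_isDTotallyDisconnected_fiber_iff.2 hπ.eq_of_comp_const
  localDiffeo O hO f hf hπf x := by
    obtain ⟨F, hF, -, -, hFe⟩ := exists_isPlot_eventuallyEq (isDOpen_euc_iff.1 hO) hf x
    obtain ⟨S, hS, hSo, hxS⟩ := eventually_nhds_iff.1 hFe
    obtain ⟨e, hxe, rfl, he⟩ := exists_openPartialHomeomorph_of_injective_fderiv
      (isPlot_iff_contDiff_euc.1 hF) (hπ.injective_fderiv F hF x (hFe.mono fun v ⟨hv, hv'⟩ =>
        hv' ▸ hπf ⟨v, hv⟩))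
    have hef : ∀ o : O, o.1 ∈ S → e o = f o := fun o ho => (hS o ho).2
    let U : Set O := {o | o.1 ∈ e.source ∩ S}
    have hfU : f '' U = e '' (e.source ∩ S) := by
      ext w
      constructor
      · rintro ⟨o, ho, rfl⟩
        exact ⟨o, ho, hef o ho.2⟩
      · rintro ⟨v, hv, rfl⟩
        exact ⟨⟨v, (hS v hv.2).1⟩, hv, ((hS v hv.2).2).symm⟩
    have hsymm : ∀ o ∈ U, e.symm (f o) = o := fun o ho => by
      rw [← hef o ho.2, e.left_inv ho.1]
    have hTo : IsOpen (e.source ∩ S) := e.open_source.inter hSo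
    have hpre : ∀ w : f '' U, ∃ o, o ∈ U ∧ f o = w := fun w => w.2
    choose k hkU hk using hpre
    have hke : ∀ w, (k w : Euc n) = e.symm w := fun w => by rw [← hsymm _ (hkU w), hk]
    refine ⟨U, ⟨hxe, hxS⟩, ?_, ?_, ?_, fun w => ⟨k w, hkU w⟩, ?_, ?_, ?_⟩
    · exact isOpen_iff_preimages_plots.2 fun k φ hφ =>
        hTo.preimage (isPlot_iff_contDiff_euc.1 (hφ.dSmooth_comp dSmooth_subtypeVal)).continuous
    · rw [isDOpen_euc_iff, hfU]
      exact e.isOpen_image_of_subset_source hTo inter_subset_left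
    · exact fun k φ hφ => hf k (fun v => φ v) hφ
    · exact fun o => Subtype.ext (Subtype.ext ((hke _).trans (hsymm o o.2)))
    · exact fun w => Subtype.ext (hk w)
    · intro i φ hφ
      refine (?_ : IsPlot fun v => (k (φ v) : Euc n))
      simp only [hke]
      refine isPlot_iff_contDiff_euc.2 (he.comp_contDiff (isPlot_iff_contDiff_euc.1 hφ) fun v => ?_)
      have hv : (φ v : Euc n) ∈ e '' (e.source ∩ S) := hfU ▸ (φ v).2
      obtain ⟨u, hu, huv⟩ := hv
      rw [← huv]
      exact e.map_source hu.1

theorem isSmoothManifold_euc (n : ℕ) : IsSmoothManifold (Euc n) :=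
  ⟨n, inferInstance, inferInstance, inferInstance, inferInstance, inferInstance,
    fun _ _ => isPlot_iff_contDiff_euc.trans contMDiff_iff_contDiff.symm⟩

/-- Every point of a smooth manifold has a neighbourhood diffeomorphic to `ℝⁿ`. -/
theorem IsSmoothManifold.exists_isLocalSubduction {M : Type*} [DiffeologicalSpace M]
    (hM : IsSmoothManifold M) (x : M) : ∃ (n : ℕ) (c : Euc n → M),
      IsLocalSubduction c ∧ Function.Injective c ∧ c 0 = x := by
  obtain ⟨n, _, _, _, -, -, hplot⟩ := hM
  let e := chartAt (EuclideanSpace ℝ (Fin n)) x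
  obtain ⟨ε, hε, hεe⟩ := Metric.isOpen_iff.1 e.open_target (e x) (mem_chart_target _ x)
  let b : Euc n → Euc n := OpenPartialHomeomorph.univBall (e x) ε
  have hb : ∀ v, b v ∈ Metric.ball (e x) ε := univBall_mem_ball _ hε
  have hbs : IsLocalSubduction b := isLocalSubduction_univBall _ hε
  have hc : IsPlot (fun v => e.symm (b v)) :=
    (hplot n _).2 ((contMDiffOn_chart_symm (x := x)).comp_contMDiff
      (contMDiff_iff_contDiff.2 (isPlot_iff_contDiff_euc.1 hbs.1.isPlot)) fun v => hεe (hb v))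
  refine ⟨n, fun v => e.symm (b v), isLocalSubduction_iff.2 ⟨hc.dSmooth, fun k φ hφ y u hy => ?_⟩,
    fun v w hvw => ?_, ?_⟩
  · have hφ' := (hplot k φ).1 hφ
    have hu : φ u ∈ e.source := hy ▸ e.map_target (hεe (hb y))
    have hψ : ContDiffOn ℝ ∞ (fun v => e (φ v)) (φ ⁻¹' e.source) :=
      contMDiffOn_iff_contDiffOn.1 ((contMDiffOn_chart (x := x)).comp hφ'.contMDiffOn
        fun v hv => hv)
    have ho : φ ⁻¹' e.source ∈ 𝓝 u := hφ'.continuous.continuousAt (e.open_source.mem_nhds hu)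
    obtain ⟨r, hr, hrU, hre⟩ := exists_contDiff_forall_mem_eventuallyEq_id ho
    obtain ⟨ψ, hψp, hψu, hψe⟩ := hbs.exists_lift (φ := fun v => e (φ (r v))) (x := y) (u := u)
      (isPlot_iff_contDiff_euc.2 (hψ.comp_contDiff hr hrU))
      (by rw [hre.self_of_nhds, id, hy, e.right_inv (hεe (hb y))])
    refine ⟨ψ, hψp, hψu, ?_⟩
    filter_upwards [hψe, hre, ho] with v h1 h2 h3
    rw [← h1, h2, id, e.left_inv h3]
  · exact injective_univBall _ _ (e.symm.injOn (hεe (hb v)) (hεe (hb w)) hvw)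
  · simp only [b, OpenPartialHomeomorph.univBall_apply_zero]
    exact e.left_inv (mem_chart_source _ x)

theorem isQUED_of_isEuclideanChart {X : Type*} [DiffeologicalSpace X]
    (h : ∀ x : X, ∃ (n : ℕ) (π : Euc n → X), IsEuclideanChart π ∧ x ∈ range π) : IsQUED X :=
  fun x => by
    obtain ⟨n, π, hπ, hx⟩ := h x
    exact ⟨Euc n, inferInstance, π, isSmoothManifold_euc n, hπ.isQuasiEtale, hx⟩

theorem IsQUED.exists_isEuclideanChart {X : Type*} [DiffeologicalSpace X] (h : IsQUED X) (x : X) :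
    ∃ (n : ℕ) (π : Euc n → X), IsEuclideanChart π ∧ π 0 = x := by
  obtain ⟨M, _, π, hM, hπ, m, rfl⟩ := h x
  obtain ⟨n, c, hc, hi, rfl⟩ := hM.exists_isLocalSubduction m
  exact ⟨n, π ∘ c, hπ.isEuclideanChart_comp hc hi, rfl⟩

theorem IsEuclideanChart.comp {X : Type*} [DiffeologicalSpace X] {n m : ℕ}
    {π : Euc n → X} (hπ : IsEuclideanChart π) {c : Euc m → Euc n} (hc : IsLocalSubduction c)
    (hi : Function.Injective c) : IsEuclideanChart (π ∘ c) :=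
  hπ.isQuasiEtale.isEuclideanChart_comp hc hi

/-! ### Quasi-étale charts adapted to a local subduction -/

section

variable {X B : Type*} [DiffeologicalSpace X] [DiffeologicalSpace B]

/-- Over a quasi-étale space, a local subduction from `ℝⁿ` with totally disconnected fibres is
automatically quasi-étale: it is locally diffeomorphic, over the base, to a quasi-étale chart. -/
theorem IsLocalSubduction.isEuclideanChart_of_isQUED (hX : IsQUED X) {n : ℕ} {π : Euc n → X}
    (hπ : IsLocalSubduction π) (htd : ∀ (m : ℕ) (φ : Euc m → Euc n), IsPlot φ →
      (∀ v w, π (φ v) = π (φ w)) → ∀ v w, φ v = φ w) : IsEuclideanChart π where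
  localSubduction := hπ
  eq_of_comp_const := htd
  injective_fderiv f hf x hx := by
    obtain ⟨s, σ, hσ, hσx⟩ := hX.exists_isEuclideanChart (π x)
    obtain ⟨g, hg, hgx, hge⟩ := hσ.localSubduction.exists_lift hπ.1.isPlot (u := x) hσx.symm
    obtain ⟨h, hh, hhx, hhe⟩ := hπ.exists_lift hσ.localSubduction.1.isPlot (u := 0) hσx
    -- `g ∘ h` is a germ over `σ`, hence `g` is a submersion at `x` and `h` an immersion at `0`.
    have hgh : Function.Injective (fderiv ℝ (g ∘ h) 0) := by
      refine hσ.injective_fderiv _ (isPlot_reparam hg (isPlot_iff_contDiff_euc.1 hh)) 0 ?_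
      filter_upwards [hhe, (IsPlot.tendsto_euc hh hhx).eventually hge] with v h1 h2
      rw [Function.comp_apply, ← h2, h1]
    rw [fderiv_comp_of_isPlot hg hh, hhx] at hgh
    have hhinj : Function.Injective (fderiv ℝ h 0) := Function.Injective.of_comp hgh
    have hgsurj : Function.Surjective (fderiv ℝ g x) :=
      Function.Surjective.of_comp ((LinearMap.injective_iff_surjective
        (f := ((fderiv ℝ g x).comp (fderiv ℝ h 0) : Euc s →ₗ[ℝ] Euc s))).1 hgh)
    -- The fibres of the submersion `g` lie in those of `π`, so they are discrete.
    obtain ⟨l, τ, j, β, hj, hji, -, hjW, -, -, -, hgj⟩ :=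
      exists_straightening_of_surjective_fderiv hg hgsurj hge
    have hl : ∀ a b : Euc l, a = b := fun a b => by
      have := htd l (fun a => j (τ.symm (0, a))) ?_ (fun v w => ?_) a b
      · simpa using hji this
      · exact isPlot_iff_contDiff_euc.2 ((isPlot_iff_contDiff_euc.1 hj.1.isPlot).comp
          (τ.symm.contDiff.comp (contDiff_const.prodMk contDiff_id)))
      · rw [hjW _, hjW _, hgj, hgj]
        simp
    -- Hence source and target of `g` have the same dimension.
    have hns : n = s := by
      have h1 := τ.toLinearEquiv.finrank_eq
      have : Subsingleton (Euc l) := ⟨hl⟩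
      rwa [Module.finrank_prod, Module.finrank_zero_of_subsingleton (M := Euc l),
        finrank_euclideanSpace_fin, finrank_euclideanSpace_fin] at h1
    subst hns
    have hhsurj : Function.Surjective (fderiv ℝ h 0) :=
      (LinearMap.injective_iff_surjective (f := (fderiv ℝ h 0 : Euc n →ₗ[ℝ] Euc n))).1 hhinj
    -- Conjugating `f` by the germs `h` and `g₁` gives a germ over `σ`.
    obtain ⟨g₁, hg₁, -, hge₁⟩ := hσ.localSubduction.exists_lift hπ.1.isPlot (u := f x) (x := 0)
      (hx.self_of_nhds.trans hσx.symm)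
    have hfh : IsPlot (f ∘ h) := isPlot_reparam hf (isPlot_iff_contDiff_euc.1 hh)
    have key : Function.Injective (fderiv ℝ (g₁ ∘ (f ∘ h)) 0) := by
      refine hσ.injective_fderiv _ (isPlot_reparam hg₁ (isPlot_iff_contDiff_euc.1 hfh)) 0 ?_
      filter_upwards [hhe, (IsPlot.tendsto_euc hh hhx).eventually hx,
        (IsPlot.tendsto_euc hfh (congrArg f hhx)).eventually hge₁] with v h1 h2 h3
      rw [Function.comp_apply, ← h3, Function.comp_apply, h2, h1]
    rw [fderiv_comp_of_isPlot hg₁ hfh, fderiv_comp_of_isPlot hf hh, hhx] at key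
    have key' : Function.Injective (fderiv ℝ f x ∘ fderiv ℝ h 0) := Function.Injective.of_comp key
    exact key'.of_comp_right hhsurj

/-- In suitable charts, a local subduction from a quasi-étale space to a manifold is a linear
projection. -/
theorem IsLocalSubduction.exists_isEuclideanChart_eq_fst {p : X → B} (hp : IsLocalSubduction p)
    (hX : IsQUED X) (hB : IsSmoothManifold B) (x : X) :
    ∃ (n k l : ℕ) (τ : Euc n ≃L[ℝ] Euc k × Euc l) (π : Euc n → X) (c : Euc k → B),
      IsEuclideanChart π ∧ π 0 = x ∧ IsLocalSubduction c ∧ Function.Injective c ∧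
      ∀ v, p (π v) = c (τ v).1 := by
  obtain ⟨n, π, hπ, rfl⟩ := hX.exists_isEuclideanChart x
  obtain ⟨k, c, hc, hci, hc0⟩ := hB.exists_isLocalSubduction (p (π 0))
  have hpπ := hp.comp hπ.localSubduction
  obtain ⟨q, hq, -, hqe⟩ := hc.exists_lift hpπ.1.isPlot (u := 0) hc0.symm
  -- Lifting `c` through `p ∘ π` gives a local section of `q`, so `q` is a submersion at `0`.
  obtain ⟨s, hs, hs0, hse⟩ := hpπ.exists_lift hc.1.isPlot (u := 0) hc0
  have hqs : Function.Surjective (fderiv ℝ q 0) := by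
    refine surjective_fderiv_of_rightInverse hq hs hs0 ?_
    filter_upwards [hse, (IsPlot.tendsto_euc hs hs0).eventually hqe] with v h1 h2
    exact hci (h2.symm.trans h1.symm)
  obtain ⟨l, τ, j, β, hj, hji, hj0, hjW, hβ, hβi, -, hqj⟩ :=
    exists_straightening_of_surjective_fderiv hq hqs hqe
  refine ⟨n, k, l, τ, π ∘ j, c ∘ β, hπ.comp hj hji, congrArg π hj0, hc.comp hβ, hci.comp hβi,
    fun v => ?_⟩
  rw [Function.comp_apply, Function.comp_apply, ← hqj]
  exact hjW v

end

/-- In a chart straightening `p`, the slices are charts of the fibres of `p`. -/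
theorem IsEuclideanChart.slice {X B : Type*} [DiffeologicalSpace X] {p : X → B}
    {n k l : ℕ} {τ : Euc n ≃L[ℝ] Euc k × Euc l} {π : Euc n → X} {c : Euc k → B}
    (hπ : IsEuclideanChart π) (hc : Function.Injective c)
    (hpπ : ∀ v, p (π v) = c (τ v).1) (t : Euc k) (hQ : IsQUED (p ⁻¹' {c t})) :
    IsEuclideanChart (fun a : Euc l =>
      (⟨π (τ.symm (t, a)), by simp [hpπ]⟩ : (p ⁻¹' {c t} : Set X))) := by
  have hι : ContDiff ℝ ∞ fun a : Euc l => τ.symm (t, a) :=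
    τ.symm.contDiff.comp (contDiff_const.prodMk contDiff_id)
  refine IsLocalSubduction.isEuclideanChart_of_isQUED hQ (isLocalSubduction_iff.2
    ⟨(?_ : IsPlot _).dSmooth, fun m φ hφ a u hu => ?_⟩) fun m φ hφ h v w => ?_
  · exact isPlot_reparam (p := π) hπ.localSubduction.1.isPlot hι
  · obtain ⟨ψ, hψ, hψu, hψe⟩ := hπ.localSubduction.exists_lift
      (hφ.dSmooth_comp dSmooth_subtypeVal) (congrArg Subtype.val hu)
    refine ⟨fun v => (τ (ψ v)).2, isPlot_iff_contDiff_euc.2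
      (contDiff_snd.comp (τ.contDiff.comp (isPlot_iff_contDiff_euc.1 hψ))), by simp [hψu], ?_⟩
    filter_upwards [hψe] with v hv
    have h1 : (τ (ψ v)).1 = t := hc (by rw [← hpπ, ← hv]; exact (φ v).2)
    refine Subtype.ext (hv.trans (congrArg π ?_))
    rw [← h1, Prod.mk.eta, τ.symm_apply_apply]
  · have := hπ.eq_of_comp_const m (fun v => τ.symm (t, φ v)) (isPlot_iff_contDiff_euc.2
      (hι.comp (isPlot_iff_contDiff_euc.1 hφ))) (fun v w => congrArg Subtype.val (h v w)) v w
    simpa using this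

/-! ### Fibre products -/

/-- The fibre product `X ×_B Y` of the maps `p : X → B` and `f : Y → B`. -/
@[ext]
structure FiberProduct {X Y B : Type*} (p : X → B) (f : Y → B) where
  /-- The component in `X`. -/
  fst : X
  /-- The component in `Y`. -/
  snd : Y
  condition : p fst = f snd

/-- The plots of the fibre product are the maps both of whose components are plots. -/
instance {X Y B : Type*} [DiffeologicalSpace X] [DiffeologicalSpace Y] (p : X → B) (f : Y → B) :
    DiffeologicalSpace (FiberProduct p f) where
  plots n := {φ | IsPlot (fun t => (φ t).fst) ∧ IsPlot (fun t => (φ t).snd)}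
  constant_plots z := ⟨isPlot_const (x := z.fst), isPlot_const (x := z.snd)⟩
  plot_reparam hφ hf := ⟨isPlot_reparam hφ.1 hf, isPlot_reparam hφ.2 hf⟩
  locality hφ := by
    refine ⟨DiffeologicalSpace.locality fun x => ?_, DiffeologicalSpace.locality fun x => ?_⟩
    all_goals obtain ⟨v, hv, hxv, h⟩ := hφ x
    · exact ⟨v, hv, hxv, fun hf hc => (h hf hc).1⟩
    · exact ⟨v, hv, hxv, fun hf hc => (h hf hc).2⟩

section

variable {X Y B : Type*} [DiffeologicalSpace X] [DiffeologicalSpace Y]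

/-- A chart of `X` straightening `p` and a chart `ρ` of `Y` yield a chart of `X ×_B Y` on the
product of the fibre direction of the former with the domain of the latter. -/
theorem IsEuclideanChart.fiberProduct {p : X → B} {f : Y → B} {n k l m r : ℕ}
    {τ : Euc n ≃L[ℝ] Euc k × Euc l} {π : Euc n → X} {c : Euc k → B} (hπ : IsEuclideanChart π)
    (hc : Function.Injective c) (hpπ : ∀ v, p (π v) = c (τ v).1) (hfib : ∀ b, IsQUED (p ⁻¹' {b}))
    {ρ : Euc m → Y} (hρ : IsEuclideanChart ρ) {q : Euc m → Euc k} (hq : IsPlot q)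
    (hfρ : ∀ v, f (ρ v) = c (q v)) (θ : Euc r ≃L[ℝ] Euc l × Euc m) :
    IsEuclideanChart (fun w => (⟨π (τ.symm (q (θ w).2, (θ w).1)), ρ (θ w).2, by
      simp [hpπ, hfρ]⟩ : FiberProduct p f)) := by
  have hq' := isPlot_iff_contDiff_euc.1 hq
  have hθ₁ : ContDiff ℝ ∞ fun w => (θ w).1 := contDiff_fst.comp θ.contDiff
  have hθ₂ : ContDiff ℝ ∞ fun w => (θ w).2 := contDiff_snd.comp θ.contDiff
  refine ⟨isLocalSubduction_iff.2 ⟨IsPlot.dSmooth ⟨?_, ?_⟩, fun i φ hφ w u hu => ?_⟩,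
    fun i φ hφ h v w => ?_, fun g hg w₀ hw => ?_⟩
  · exact isPlot_reparam (p := π) hπ.localSubduction.1.isPlot
      (τ.symm.contDiff.comp ((hq'.comp hθ₂).prodMk hθ₁))
  · exact isPlot_reparam (p := ρ) hρ.localSubduction.1.isPlot hθ₂
  · obtain ⟨ψ, hψ, hψu, hψe⟩ := hπ.localSubduction.exists_lift hφ.1 (congrArg FiberProduct.fst hu)
    obtain ⟨χ, hχ, hχu, hχe⟩ := hρ.localSubduction.exists_lift hφ.2 (congrArg FiberProduct.snd hu)
    refine ⟨fun v => θ.symm ((τ (ψ v)).2, χ v), isPlot_iff_contDiff_euc.2 (θ.symm.contDiff.comp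
      ((contDiff_snd.comp (τ.contDiff.comp (isPlot_iff_contDiff_euc.1 hψ))).prodMk
        (isPlot_iff_contDiff_euc.1 hχ))), by simp [hψu, hχu], ?_⟩
    filter_upwards [hψe, hχe] with v h1 h2
    have h3 : (τ (ψ v)).1 = q (χ v) :=
      hc (by rw [← hpπ, ← hfρ, ← h1, ← h2]; exact (φ v).condition)
    ext
    · simp only [ContinuousLinearEquiv.apply_symm_apply, ← h3, Prod.mk.eta,
        ContinuousLinearEquiv.symm_apply_apply, h1]
    · simp only [ContinuousLinearEquiv.apply_symm_apply, h2]
  · have hφ' := isPlot_iff_contDiff_euc.1 hφ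
    have h2 := hρ.eq_of_comp_const i (fun v => (θ (φ v)).2)
      (isPlot_iff_contDiff_euc.2 (hθ₂.comp hφ')) fun v w => congrArg FiberProduct.snd (h v w)
    have h1 := hπ.eq_of_comp_const i (fun v => τ.symm (q (θ (φ v)).2, (θ (φ v)).1))
      (isPlot_iff_contDiff_euc.2 (τ.symm.contDiff.comp ((hq'.comp (hθ₂.comp hφ')).prodMk
        (hθ₁.comp hφ')))) (fun v w => congrArg FiberProduct.fst (h v w)) v w
    exact θ.injective (Prod.ext (congrArg Prod.snd (τ.symm.injective h1)) (h2 v w))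
  · -- In the coordinates `(a, v)` of `θ`, the derivative of `g` is block triangular with
    -- injective diagonal blocks.
    have hg' := isPlot_iff_contDiff_euc.1 hg
    obtain ⟨⟨a₀, v₀⟩, rfl⟩ := θ.symm.surjective w₀
    let G := fderiv ℝ g (θ.symm (a₀, v₀))
    have hgG : HasFDerivAt (fun z => θ (g (θ.symm z)))
        ((θ : Euc r →L[ℝ] Euc l × Euc m).comp
          (G.comp (θ.symm : Euc l × Euc m →L[ℝ] Euc r))) (a₀, v₀) :=
      θ.hasFDerivAt.comp _ (((hg'.differentiable (by simp) _).hasFDerivAt).comp _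
        θ.symm.hasFDerivAt)
    have hgS : ContDiff ℝ ∞ fun z => θ (g (θ.symm z)) :=
      θ.contDiff.comp (hg'.comp θ.symm.contDiff)
    have hw' : ∀ᶠ z in 𝓝 (a₀, v₀),
        π (τ.symm (q (θ (g (θ.symm z))).2, (θ (g (θ.symm z))).1)) = π (τ.symm (q z.2, z.1)) ∧
        ρ (θ (g (θ.symm z))).2 = ρ z.2 := by
      filter_upwards [θ.symm.continuous.continuousAt.eventually hw] with z hz
      exact ⟨by simpa using congrArg FiberProduct.fst hz,
        by simpa using congrArg FiberProduct.snd hz⟩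
    have hι₁ : HasFDerivAt (fun a : Euc l => (a, v₀)) (ContinuousLinearMap.inl ℝ (Euc l) (Euc m))
        a₀ := (hasFDerivAt_id a₀).prodMk (hasFDerivAt_const v₀ a₀)
    have hι₂ : HasFDerivAt (fun v : Euc m => (a₀, v)) (ContinuousLinearMap.inr ℝ (Euc l) (Euc m))
        v₀ := (hasFDerivAt_const a₀ v₀).prodMk (hasFDerivAt_id v₀)
    have hw₁ : ∀ᶠ a in 𝓝 a₀, _ :=
      (hι₁.continuousAt : Tendsto _ _ (𝓝 (a₀, v₀))).eventually hw'
    have hw₂ : ∀ᶠ v in 𝓝 v₀, _ :=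
      (hι₂.continuousAt : Tendsto _ _ (𝓝 (a₀, v₀))).eventually hw'
    have hs₁ : ContDiff ℝ ∞ fun a => θ (g (θ.symm (a, v₀))) :=
      hgS.comp (contDiff_id.prodMk contDiff_const)
    have hs₂ : ContDiff ℝ ∞ fun v => θ (g (θ.symm (a₀, v))) :=
      hgS.comp (contDiff_const.prodMk contDiff_id)
    -- The second component along `v` is a germ over `ρ`.
    have h22 := hρ.injective_fderiv (fun v => (θ (g (θ.symm (a₀, v)))).2)
      (isPlot_iff_contDiff_euc.2 (contDiff_snd.comp hs₂)) v₀ (hw₂.mono fun v hv => hv.2)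
    -- The second component along `a` stays in a fibre of `ρ`.
    have h21 : fderiv ℝ (fun a => (θ (g (θ.symm (a, v₀)))).2) a₀ = 0 := by
      obtain ⟨ret, hr, hrU, hre⟩ := exists_contDiff_forall_mem_eventuallyEq_id hw₁
      have hconst := hρ.eq_of_comp_const l (fun a => (θ (g (θ.symm (ret a, v₀)))).2)
        (isPlot_iff_contDiff_euc.2 (contDiff_snd.comp (hs₁.comp hr)))
        (fun a b => (hrU a).2.trans (hrU b).2.symm)
      have : (fun a => (θ (g (θ.symm (a, v₀)))).2) =ᶠ[𝓝 a₀]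
          fun _ => (θ (g (θ.symm (ret a₀, v₀)))).2 := by
        filter_upwards [hre] with a ha
        rw [← hconst a a₀, ha, id]
      rw [this.fderiv_eq, fderiv_const_apply]
    -- The first component along `a` is a germ over the slice of `π` through `q v₀`.
    have h11 := (hπ.slice hc hpπ (q v₀) (hfib _)).injective_fderiv
      (fun a => (θ (g (θ.symm (a, v₀)))).1) (isPlot_iff_contDiff_euc.2 (contDiff_fst.comp hs₁)) a₀
      (by
        filter_upwards [hw₁] with a ha
        have hqa : q (θ (g (θ.symm (a, v₀)))).2 = q v₀ := hc (by rw [← hfρ, ← hfρ, ha.2])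
        exact Subtype.ext ((congrArg (fun t => π (τ.symm (t, _))) hqa.symm).trans ha.1))
    have d₁ := hgG.comp a₀ hι₁
    have d₂ := hgG.comp v₀ hι₂
    have d22 : HasFDerivAt (fun v => (θ (g (θ.symm (a₀, v)))).2) _ v₀ := d₂.snd
    have d11 : HasFDerivAt (fun a => (θ (g (θ.symm (a, v₀)))).1) _ a₀ := d₁.fst
    have d21 : HasFDerivAt (fun a => (θ (g (θ.symm (a, v₀)))).2) _ a₀ := d₁.snd
    rw [d22.fderiv] at h22
    rw [d11.fderiv] at h11
    rw [d21.fderiv] at h21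
    refine (injective_iff_map_eq_zero G).2 fun d hd => ?_
    obtain ⟨⟨a, v⟩, rfl⟩ := θ.symm.surjective d
    have hsplit : ((a, v) : Euc l × Euc m) = (a, 0) + (0, v) := by simp
    have ha2 : (θ (G (θ.symm (a, 0)))).2 = 0 := DFunLike.congr_fun h21 a
    have hv0 : v = 0 := by
      refine (injective_iff_map_eq_zero _).1 h22 v (?_ : (θ (G (θ.symm (0, v)))).2 = 0)
      have h : (θ (G (θ.symm (a, v)))).2 = 0 := by rw [hd, map_zero, Prod.snd_zero]
      rwa [hsplit, map_add, map_add, map_add, Prod.snd_add, ha2, zero_add] at h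
    subst hv0
    have ha0 : a = 0 := by
      refine (injective_iff_map_eq_zero _).1 h11 a (?_ : (θ (G (θ.symm (a, 0)))).1 = 0)
      simp [hd]
    subst ha0
    exact map_zero θ.symm

/-- The fibre product of a local subduction with quasi-étale fibres to a manifold and of any
smooth map from a quasi-étale space is quasi-étale. -/
theorem isQUED_fiberProduct [DiffeologicalSpace B] {p : X → B} {f : Y → B} (hX : IsQUED X)
    (hY : IsQUED Y) (hB : IsSmoothManifold B) (hp : IsLocalSubduction p) (hf : DSmooth f)
    (hfib : ∀ b, IsQUED (p ⁻¹' {b})) : IsQUED (FiberProduct p f) := by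
  refine isQUED_of_isEuclideanChart fun ⟨x, y, hxy⟩ => ?_
  obtain ⟨n, k, l, τ, π, c, hπ, rfl, hc, hci, hpπ⟩ := hp.exists_isEuclideanChart_eq_fst hX hB x
  obtain ⟨m, ρ, hρ, rfl⟩ := hY.exists_isEuclideanChart y
  obtain ⟨q, hq, hq0, hqe⟩ := hc.exists_lift
    (hρ.localSubduction.1.isPlot.dSmooth_comp hf) (x := 0) (u := 0)
    (by rw [Function.comp_apply, ← hxy, hpπ, map_zero, Prod.fst_zero])
  -- Shrink the chart `ρ` to a ball on which `f ∘ ρ` factors through `c`.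
  obtain ⟨ε, hε, hεq⟩ := Metric.eventually_nhds_iff_ball.1 hqe
  let b : Euc m → Euc m := OpenPartialHomeomorph.univBall 0 ε
  have hb : IsLocalSubduction b := isLocalSubduction_univBall 0 hε
  have hb0 : b 0 = 0 := OpenPartialHomeomorph.univBall_apply_zero 0 ε
  let θ : Euc (l + m) ≃L[ℝ] Euc l × Euc m := ContinuousLinearEquiv.ofFinrankEq (by simp)
  refine ⟨l + m, _, hπ.fiberProduct hci hpπ hfib (hρ.comp hb (injective_univBall 0 ε))
    (isPlot_reparam hq (isPlot_iff_contDiff_euc.1 hb.1.isPlot))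
    (fun v => hεq _ (univBall_mem_ball 0 hε v)) θ, 0, ?_⟩
  ext
  · simp only [map_zero, Prod.snd_zero, Prod.fst_zero, Function.comp_apply, hb0, hq0,
      Prod.mk_zero_zero]
  · simp [hb0]

end

/-! ### Fibre products in the category of quasi-étale spaces -/

/-- The fibre product of diffeological spaces is the fibre product in `QUED` as soon as it is
quasi-étale. -/
theorem hasPullback_of_isQUED_fiberProduct {X Y B : QUED.{u}} (p : X ⟶ B) (f : Y ⟶ B)
    (h : IsQUED (FiberProduct (QUED.map p) (QUED.map f))) : Limits.HasPullback p f := by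
  let P : QUED.{u} := ⟨⟨FiberProduct (QUED.map p) (QUED.map f)⟩, h⟩
  let a : P ⟶ X := ObjectProperty.homMk ⟨FiberProduct.fst, fun _ _ hφ => hφ.1⟩
  let b : P ⟶ Y := ObjectProperty.homMk ⟨FiberProduct.snd, fun _ _ hφ => hφ.2⟩
  have hab : a ≫ p = b ≫ f := by
    refine ObjectProperty.hom_ext _ (Diffgl.Hom.ext ?_)
    exact funext fun z : FiberProduct (QUED.map p) (QUED.map f) => z.condition
  refine ⟨⟨⟨Limits.PullbackCone.mk a b hab, Limits.PullbackCone.IsLimit.mk hab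
    (fun s => ObjectProperty.homMk ⟨fun w => ⟨QUED.map s.fst w, QUED.map s.snd w, ?_⟩,
      fun n φ hφ => ⟨s.fst.hom.smooth n φ hφ, s.snd.hom.smooth n φ hφ⟩⟩) ?_ ?_ ?_⟩⟩⟩
  · exact congrFun (congrArg (fun g => QUED.map g) s.condition) w
  · exact fun s => rfl
  · exact fun s => rfl
  · intro s m h₁ h₂
    refine ObjectProperty.hom_ext _ (Diffgl.Hom.ext (funext fun w => ?_))
    refine FiberProduct.ext ?_ ?_
    · exact congrFun (congrArg (fun g => QUED.map g) h₁) w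
    · exact congrFun (congrArg (fun g => QUED.map g) h₂) w

/-- The diffeology of `ℝⁿ`, lifted to the universe `u`. -/
instance (n : ℕ) : DiffeologicalSpace (ULift.{u} (Euc n)) where
  plots m := {φ | IsPlot fun t => (φ t).down}
  constant_plots x := isPlot_const (x := x.down)
  plot_reparam {_ _ p _} hφ hf := isPlot_reparam (p := fun t => (p t).down) hφ hf
  locality {_ p} hφ := DiffeologicalSpace.locality (p := fun t => (p t).down) fun x => by
    obtain ⟨v, hv, hxv, h⟩ := hφ x
    exact ⟨v, hv, hxv, fun hf hc => h hf hc⟩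

theorem isQUED_ulift_euc (n : ℕ) : IsQUED (ULift.{u} (Euc n)) := by
  refine isQUED_of_isEuclideanChart fun x => ⟨n, ULift.up, ?_, x.down, rfl⟩
  refine IsLocalSubduction.isEuclideanChart (isLocalSubduction_iff.2 ⟨fun _ _ hφ => hφ,
    fun m φ hφ x u hu => ⟨fun v => (φ v).down, hφ, congrArg ULift.down hu, ?_⟩⟩) ULift.up_injective
  exact Eventually.of_forall fun v => rfl

/-- `ℝⁿ` as an object of `QUED`. -/
def QUED.euc (n : ℕ) : QUED.{u} := ⟨⟨ULift.{u} (Euc n)⟩, isQUED_ulift_euc n⟩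

/-- The morphism from `ℝⁿ` given by a plot. -/
def QUED.ofPlot {X : QUED.{u}} {n : ℕ} {φ : Euc n → X.space} (hφ : IsPlot φ) : QUED.euc n ⟶ X :=
  ObjectProperty.homMk ⟨fun t : ULift (Euc n) => φ t.down, fun _ ψ hψ =>
    IsPlot.dSmooth_comp' (p := fun t => (ψ t).down) hψ hφ.dSmooth⟩

/-- Quasi-étaleness descends along smooth bijections that lift plots. -/
theorem IsQUED.of_injective_of_lift {P F : Type*} [DiffeologicalSpace P] [DiffeologicalSpace F]
    (hP : IsQUED P) {e : P → F} (he : DSmooth e) (hi : Function.Injective e)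
    (hl : ∀ (n : ℕ) (φ : Euc n → F), IsPlot φ → ∃ ψ : Euc n → P, IsPlot ψ ∧ ∀ v, e (ψ v) = φ v) :
    IsQUED F := by
  have hlsub : IsLocalSubduction e := isLocalSubduction_iff.2 ⟨he, fun n φ hφ x u hu => by
    obtain ⟨ψ, hψ, h⟩ := hl n φ hφ
    exact ⟨ψ, hψ, hi ((h u).trans hu), Eventually.of_forall fun v => (h v).symm⟩⟩
  refine isQUED_of_isEuclideanChart fun x => ?_
  obtain ⟨ψ, -, h⟩ := hl 0 (fun _ => x) isPlot_const
  obtain ⟨n, π, hπ, hπ0⟩ := hP.exists_isEuclideanChart (ψ 0)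
  refine ⟨n, e ∘ π, ⟨hlsub.comp hπ.localSubduction, fun m φ hφ hc => ?_,
    fun f hf y hy => ?_⟩, 0, ?_⟩
  · exact hπ.eq_of_comp_const m φ hφ fun v w => hi (hc v w)
  · exact hπ.injective_fderiv f hf y (hy.mono fun v hv => hi hv)
  · rw [Function.comp_apply, hπ0, h]

/-- The fibres of a cartesian morphism of `QUED` are quasi-étale: the fibre product with a point,
tested against the spaces `ℝⁿ`, is the fibre. -/
theorem IsCartesianMorphism.isQUED_fiber {X B : QUED.{u}} {p : X ⟶ B} (hp : IsCartesianMorphism p)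
    (b : B.space) : IsQUED (QUED.map p ⁻¹' {b}) := by
  intro x
  -- A point of the fibre yields a commutative square, so the fibre product with `b` exists.
  let f : QUED.euc.{u} 0 ⟶ B := QUED.ofPlot (φ := fun _ => b) isPlot_const
  have hpf : Limits.HasPullback p f := (hp f).resolve_right fun h => h
    ⟨QUED.euc 0, QUED.ofPlot (φ := fun _ => (x : X.space)) isPlot_const, 𝟙 _,
      ObjectProperty.hom_ext _ (Diffgl.Hom.ext (funext fun _ => x.2))⟩
  have hmem : ∀ z, QUED.map p (QUED.map (Limits.pullback.fst p f) z) = b := fun z =>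
    congrFun (congrArg (fun g => QUED.map g) (Limits.pullback.condition (f := p) (g := f))) z
  have hsub : ∀ {W : QUED.{u}} (g h : W ⟶ QUED.euc.{u} 0), g = h := fun g h =>
    ObjectProperty.hom_ext _ (Diffgl.Hom.ext (funext fun w =>
      ULift.ext _ _ (Subsingleton.elim (α := Euc 0) _ _)))
  refine IsQUED.of_injective_of_lift (Limits.pullback p f).property
    (e := fun z => ⟨QUED.map (Limits.pullback.fst p f) z, hmem z⟩)
    (fun n φ hφ => (Limits.pullback.fst p f).hom.smooth n φ hφ) (fun z w hzw => ?_)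
    (fun n φ hφ => ?_) x
  -- Injectivity on points: test against `ℝ⁰`.
  · let z' : QUED.euc.{u} 0 ⟶ Limits.pullback p f := QUED.ofPlot (φ := fun _ => z) isPlot_const
    let w' : QUED.euc.{u} 0 ⟶ Limits.pullback p f := QUED.ofPlot (φ := fun _ => w) isPlot_const
    have : z' = w' := Limits.pullback.hom_ext
      (ObjectProperty.hom_ext _ (Diffgl.Hom.ext (funext fun _ => congrArg Subtype.val hzw)))
      (hsub _ _)
    exact congrFun (congrArg (fun g => QUED.map g) this) (ULift.up 0)
  -- Plots of the fibre lift: test against `ℝⁿ`.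
  · let a : QUED.euc.{u} n ⟶ X := QUED.ofPlot (hφ.dSmooth_comp dSmooth_subtypeVal)
    let o : QUED.euc.{u} n ⟶ QUED.euc.{u} 0 :=
      QUED.ofPlot (φ := fun _ => (ULift.up 0 : ULift.{u} (Euc 0))) isPlot_const
    have hao : a ≫ p = o ≫ f :=
      ObjectProperty.hom_ext _ (Diffgl.Hom.ext (funext fun t => (φ t.down).2))
    have hs := (Limits.pullback.lift a o hao).hom.smooth
    refine ⟨fun t => QUED.map (Limits.pullback.lift a o hao) (ULift.up t),
      hs n ULift.up isPlot_id, fun v => Subtype.ext ?_⟩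
    exact congrFun (congrArg (fun g => QUED.map g) (Limits.pullback.lift_fst a o hao)) (ULift.up v)

end QuasiEtale

theorem mainTheorem6 (X B : QuasiEtale.QUED.{u}) (p : X ⟶ B)
    (hB : QuasiEtale.IsSmoothManifold B.space)
    (hp : QuasiEtale.IsLocalSubduction (QuasiEtale.QUED.map p)) :
    QuasiEtale.IsQUEDSubmersion p ↔
      ∀ b : B.space, QuasiEtale.IsQUED (QuasiEtale.QUED.map p ⁻¹' {b}) :=
  ⟨fun h b => h.2.isQUED_fiber b, fun h => ⟨hp, fun Y f => Or.inl
    (QuasiEtale.hasPullback_of_isQUED_fiberProduct p f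
      (QuasiEtale.isQUED_fiberProduct X.property Y.property hB hp f.hom.smooth h))⟩⟩
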